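/- Let $n\in\mathbb{N}$ and let $\Omega_n=\{1<2<\cdots<n\}$. A sequence $(a_1,\ldots,a_t)$ in $\Omega_n$ is called cyclic if there is at most one index $i\in\{1,\ldots,t\}$ with $a_i>a_{i+1}$, where $a_{t+1}=a_1$. An injective partial transformation $\alpha$ of $\Omega_n$ with domain $\{a_1<\cdots<a_t\}$ ($t\ge 0$) is orientation-preserving if the sequence $(a_1\alpha,\ldots,a_t\alpha)$ is cyclic. Let $\mathcal{POPI}_n$ be the monoid, under composition, of all injective orientation-preserving partial transformations of $\Omega_n$ and, for a nonempty subset $Y$ of $\Omega_n$, let $$\mathcal{POPI}_n(Y)=\{\alpha\in\mathcal{POPI}_n \mid \mathrm{Im}(\alpha)\subseteq Y\}.$$ Let $\mathcal{D}_{2n}$ denote the subgroup of the symmetric group on $\Omega_n$ generated by the permutations $g: i\mapsto i+1$ ($1\le i<n$), $n\mapsto 1$, and $h: i\mapsto n+1-i$ (for $n\ge 3$ it is the dihedral group of order $2n$). **Theorem.** Let $Y$ and $Z$ be nonempty subsets of $\Omega_n$. Then the semigroups $\mathcal{POPI}_n(Y)$ and $\mathcal{POPI}_n(Z)$ are isomorphic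 if and only if $|Y|=|Z|\le 2$ or $Y\delta=Z$ for some $\delta\in\mathcal{D}_{2n}$. -/

import Mathlib

/-- A sequence `a = (a_1, …, a_t)` of elements of a chain is cyclic if there is at most one index
`i` with `a_i > a_{i+1}`, where `a_{t+1} = a_1` (`finRotate t` is `i ↦ i + 1` modulo `t`). -/
def IsCyclicSeq {n t : ℕ} (a : Fin t → Fin n) : Prop :=
  ∀ i j : Fin t, a (finRotate t i) < a i → a (finRotate t j) < a j → i = j

/-- The symmetric inverse monoid on the `n`-element chain: all injective partial transformations
(partial permutations) of `Fin n`. -/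
def SymInvMonoid (n : ℕ) : Type := Fin n ≃. Fin n

namespace SymInvMonoid

variable {n : ℕ}

/-- The value of a partial permutation at `x`, `none` when `x` lies outside the domain. -/
def app (α : SymInvMonoid n) (x : Fin n) : Option (Fin n) := PEquiv.toFun α x

/-- Transformations act on the right: `α * β` means first `α`, then `β`. -/
instance : Monoid (SymInvMonoid n) where
  mul α β := PEquiv.trans α β
  one := PEquiv.refl (Fin n)
  mul_assoc α β γ := PEquiv.trans_assoc α β γ
  one_mul α := PEquiv.refl_trans α
  mul_one α := PEquiv.trans_refl α

theorem app_mul (α β : SymInvMonoid n) (x : Fin n) : (α * β).app x = (α.app x).bind β.app := rfl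

theorem app_one (x : Fin n) : (1 : SymInvMonoid n).app x = some x := rfl

theorem app_inj (α : SymInvMonoid n) {x y z : Fin n} (hx : α.app x = some z)
    (hy : α.app y = some z) : x = y :=
  PEquiv.inj α hx hy

theorem app_mul_eq_some (α β : SymInvMonoid n) (x z : Fin n) :
    (α * β).app x = some z ↔ ∃ y, α.app x = some y ∧ β.app y = some z := by
  rw [app_mul, Option.bind_eq_some_iff]

/-- The domain. -/
def dom (α : SymInvMonoid n) : Finset (Fin n) := Finset.univ.filter fun x => (α.app x).isSome

/-- The image (range). -/
def im (α : SymInvMonoid n) : Finset (Fin n) := Finset.univ.filter fun y => ∃ x, α.app x = some y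

theorem isSome_app_orderEmb (α : SymInvMonoid n) (i : Fin α.dom.card) :
    (α.app (α.dom.orderEmbOfFin rfl i)).isSome :=
  (Finset.mem_filter.1 (α.dom.orderEmbOfFin_mem rfl i)).2

/-- If the domain is `{a_1 < ⋯ < a_t}`, this is the sequence `(a_1 α, …, a_t α)`. -/
def imageSeq (α : SymInvMonoid n) (i : Fin α.dom.card) : Fin n :=
  (α.app (α.dom.orderEmbOfFin rfl i)).get (α.isSome_app_orderEmb i)

/-- `α` is orientation-preserving if the sequence of its images is cyclic. -/
def IsOrientationPreserving (α : SymInvMonoid n) : Prop := IsCyclicSeq α.imageSeq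

end SymInvMonoid

/-! Orientation-preserving partial permutations are closed under composition. -/

theorem IsCyclicSeq.exists_drop {n t : ℕ} (a : Fin t → Fin n) (p q : Fin t) (hpq : p ≤ q)
    (h : ∀ s : Fin t, p ≤ s → s < q → a s ≤ a (finRotate t s)) : a p ≤ a q := by
  obtain ⟨p, hp⟩ := p
  obtain ⟨q, hq⟩ := q
  simp only [Fin.mk_le_mk] at hpq
  induction q, hpq using Nat.le_induction with
  | base => exact le_rfl
  | succ q hpq ih =>
    have h1 := ih (by omega) (fun s hs hs' => h s hs (lt_trans hs' (by simp)))
    have h2 := h ⟨q, by omega⟩ hpq (by simp)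
    obtain _ | t := t
    · omega
    · rw [finRotate_of_lt (by omega)] at h2
      exact h1.trans h2

theorem isCyclicSeq_iff {n t : ℕ} (a : Fin t → Fin n) (ha : Function.Injective a) :
    IsCyclicSeq a ↔ ∀ i j k : Fin t, i < j → j < k → sbtw (a i) (a j) (a k) := by
  obtain _ | t := t
  · exact ⟨fun _ i => i.elim0, fun _ i => i.elim0⟩
  have hsb : ∀ x y z : Fin n, sbtw x y z ↔ (x < y ∧ y < z ∨ y < z ∧ z < x ∨ z < x ∧ x < y) :=
    fun _ _ _ => Iff.rfl
  simp only [hsb]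
  constructor
  · intro hc i j k hij hjk
    have drop : ∀ p q : Fin (t + 1), p < q → a q < a p →
        ∃ s, p ≤ s ∧ s < q ∧ a (finRotate _ s) < a s := by
      intro p q hpq hlt
      by_contra! hcon
      exact absurd (IsCyclicSeq.exists_drop a p q hpq.le hcon) (not_le.2 hlt)
    have wrap : a i < a k → ∃ s, (k ≤ s ∨ s < i) ∧ a (finRotate _ s) < a s := by
      intro hlt
      by_contra! hcon
      have h1 := IsCyclicSeq.exists_drop a k (Fin.last t) (Fin.le_last k)
        fun s hs _ => hcon s (Or.inl hs)
      have h2 := hcon (Fin.last t) (Or.inl (Fin.le_last k))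
      rw [finRotate_last] at h2
      have h3 := IsCyclicSeq.exists_drop a 0 i (Fin.zero_le i) fun s _ hs => hcon s (Or.inr hs)
      exact absurd (h1.trans (h2.trans h3)) (not_le.2 hlt)
    have nij : a i ≠ a j := fun h => hij.ne (ha h)
    have njk : a j ≠ a k := fun h => hjk.ne (ha h)
    have nik : a i ≠ a k := fun h => (hij.trans hjk).ne (ha h)
    by_cases h1 : a j < a i
    · obtain ⟨s, hs1, hs2, hs3⟩ := drop i j hij h1
      by_cases h2 : a k < a j
      · obtain ⟨r, hr1, hr2, hr3⟩ := drop j k hjk h2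
        have := hc s r hs3 hr3
        omega
      · by_cases h3 : a i < a k
        · obtain ⟨r, hr1, hr3⟩ := wrap h3
          have := hc s r hs3 hr3
          omega
        · omega
    · by_cases h2 : a k < a j
      · obtain ⟨s, hs1, hs2, hs3⟩ := drop j k hjk h2
        by_cases h3 : a i < a k
        · obtain ⟨r, hr1, hr3⟩ := wrap h3
          have := hc s r hs3 hr3
          omega
        · omega
      · omega
  · intro h
    suffices key : ∀ p q : Fin (t + 1), p < q → a (finRotate _ p) < a p →
        a (finRotate _ q) < a q → False by
      intro i j hi hj
      rcases lt_trichotomy i j with hij | hij | hij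
      · exact (key i j hij hi hj).elim
      · exact hij
      · exact (key j i hij hj hi).elim
    intro p q hpq hp hq
    have hp' : (finRotate (t + 1) p : ℕ) = p + 1 := coe_finRotate_of_ne_last (by
      rintro rfl
      exact absurd (Fin.le_last q) (not_le.2 hpq))
    have hq' : (finRotate (t + 1) q : ℕ) = q + 1 ∨ (finRotate (t + 1) q : ℕ) = 0 := by
      by_cases hl : q = Fin.last t
      · right
        rw [hl, finRotate_last]
        rfl
      · exact Or.inl (coe_finRotate_of_ne_last hl)
    generalize finRotate (t + 1) p = p' at *
    generalize finRotate (t + 1) q = q' at *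
    have e1 : p' < q ∨ p' = q := by omega
    rcases hq' with hq' | hq'
    · have a1 := h p p' q' (by omega) (by omega)
      rcases e1 with e1 | rfl
      · have a2 := h p' q q' e1 (by omega)
        have a3 := h p p' q (by omega) e1
        omega
      · omega
    · have e2 : q' = p ∨ q' < p := by omega
      rcases e2 with rfl | e2
      · rcases e1 with e1 | rfl
        · have a3 := h q' p' q (by omega) e1
          omega
        · omega
      · have a1 := h q' p p' e2 (by omega)
        rcases e1 with e1 | rfl
        · have a3 := h q' p' q (by omega) e1
          omega
        · omega

namespace SymInvMonoid

variable {n : ℕ}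

theorem isOrientationPreserving_iff (α : SymInvMonoid n) :
    α.IsOrientationPreserving ↔ ∀ x y z x' y' z' : Fin n, x < y → y < z →
      α.app x = some x' → α.app y = some y' → α.app z = some z' → sbtw x' y' z' := by
  have hseq : ∀ i, α.app (α.dom.orderEmbOfFin rfl i) = some (α.imageSeq i) := fun i =>
    (Option.some_get _).symm
  have hinj : Function.Injective α.imageSeq := fun i j hij =>
    (α.dom.orderEmbOfFin rfl).injective (α.app_inj (hseq i) (hij ▸ hseq j))
  have hsurj : ∀ x x', α.app x = some x' →
      ∃ i, α.dom.orderEmbOfFin rfl i = x ∧ α.imageSeq i = x' := by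
    intro x x' hx
    have hmem : x ∈ Set.range (α.dom.orderEmbOfFin rfl) := by
      rw [Finset.range_orderEmbOfFin]
      simp [dom, hx]
    obtain ⟨i, rfl⟩ := hmem
    exact ⟨i, rfl, Option.some_injective _ ((hseq i).symm.trans hx)⟩
  rw [IsOrientationPreserving, isCyclicSeq_iff _ hinj]
  constructor
  · intro h x y z x' y' z' hxy hyz hx hy hz
    obtain ⟨i, rfl, rfl⟩ := hsurj x x' hx
    obtain ⟨j, rfl, rfl⟩ := hsurj y y' hy
    obtain ⟨k, rfl, rfl⟩ := hsurj z z' hz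
    exact h i j k (by simpa using hxy) (by simpa using hyz)
  · intro h i j k hij hjk
    exact h _ _ _ _ _ _ (by simpa using hij) (by simpa using hjk) (hseq i) (hseq j) (hseq k)

theorem IsOrientationPreserving.mul {α β : SymInvMonoid n} (hα : α.IsOrientationPreserving)
    (hβ : β.IsOrientationPreserving) : (α * β).IsOrientationPreserving := by
  rw [isOrientationPreserving_iff] at *
  intro x y z x' y' z' hxy hyz hx hy hz
  obtain ⟨u, hu, hu'⟩ := (app_mul_eq_some ..).1 hx
  obtain ⟨v, hv, hv'⟩ := (app_mul_eq_some ..).1 hy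
  obtain ⟨w, hw, hw'⟩ := (app_mul_eq_some ..).1 hz
  rcases hα x y z u v w hxy hyz hu hv hw with ⟨h1, h2⟩ | ⟨h1, h2⟩ | ⟨h1, h2⟩
  · exact hβ _ _ _ _ _ _ h1 h2 hu' hv' hw'
  · exact (hβ _ _ _ _ _ _ h1 h2 hv' hw' hu').cyclic_right
  · exact (hβ _ _ _ _ _ _ h1 h2 hw' hu' hv').cyclic_left

theorem isOrientationPreserving_one : (1 : SymInvMonoid n).IsOrientationPreserving := by
  rw [isOrientationPreserving_iff]
  intro x y z x' y' z' hxy hyz hx hy hz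
  rw [app_one, Option.some_inj] at hx hy hz
  subst hx hy hz
  exact Or.inl ⟨hxy, hyz⟩

theorem im_mul_subset (α β : SymInvMonoid n) : (α * β).im ⊆ β.im := by
  intro z hz
  simp only [im, Finset.mem_filter, Finset.mem_univ, true_and] at hz ⊢
  obtain ⟨x, hx⟩ := hz
  obtain ⟨y, -, hy⟩ := (app_mul_eq_some ..).1 hx
  exact ⟨y, hy⟩

end SymInvMonoid

/-- The monoid of all injective orientation-preserving partial transformations of the chain
`Fin n`. -/
def POPI (n : ℕ) : Submonoid (SymInvMonoid n) where
  carrier := {α | α.IsOrientationPreserving}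
  mul_mem' := SymInvMonoid.IsOrientationPreserving.mul
  one_mem' := SymInvMonoid.isOrientationPreserving_one

/-- The semigroup of all elements of `POPI n` whose image is contained in `Y`. -/
def POPIRestricted {n : ℕ} (Y : Finset (Fin n)) : Subsemigroup (SymInvMonoid n) where
  carrier := {α | α ∈ POPI n ∧ α.im ⊆ Y}
  mul_mem' := fun {α β} hα hβ =>
    ⟨(POPI n).mul_mem hα.1 hβ.1, (SymInvMonoid.im_mul_subset α β).trans hβ.2⟩

/-- The subgroup of the symmetric group on `Fin n` generated by the rotation `i ↦ i + 1` (mod `n`)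
and the reversal `i ↦ n - 1 - i`; for `n ≥ 3` it is the dihedral group of order `2n`. -/
def dihedralPerm (n : ℕ) : Subgroup (Equiv.Perm (Fin n)) :=
  Subgroup.closure {finRotate n, Fin.revPerm}

/-!
The theorem rests on one observation: every isomorphism `φ : POPIRestricted Y ≃* POPIRestricted Z`
is conjugation by a permutation `τ` of the chain with `Y τ = Z`
(`exists_perm_app_of_mulEquiv`). Indeed, the rank-one elements `x ↦ y` (`y ∈ Y`) are exactly the
elements `α ≠ 0` such that `α f ∈ {α, 0}` for all idempotents `f`, so `φ` permutes them. The
products `(x ↦ y)(y ↦ y') = (x ↦ y')` force `φ (x ↦ y) = (τ x ↦ τ y)`, and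
`α (y ↦ y) = (x ↦ y)` whenever `x α = y`, which describes `φ α` for all `α`.

If `Y` has at least three elements, fix a cyclically ordered triple of points of `Y`. Every
cyclically ordered triple of the chain is carried to it by an orientation-preserving map with
image in `Y`. Applying `φ` shows that `τ` acts on the orientation of all triples as it does on that
of the fixed one: it preserves all orientations or reverses all of them. Such permutations form the
dihedral group (`mem_dihedralPerm_iff`): after multiplication by a reversal and a rotation they
preserve the order and hence are trivial.

Conversely, conjugation by a dihedral permutation preserves orientation-preserving maps, and maps
of rank at most two are always orientation-preserving, so that when `|Y| = |Z| ≤ 2` conjugation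
by any permutation taking `Y` to `Z` will do.
-/

/-! ### The cyclic order of the chain -/

theorem Fin.sbtw_def {n : ℕ} (x y z : Fin n) :
    sbtw x y z ↔ (x < y ∧ y < z ∨ y < z ∧ z < x ∨ z < x ∧ x < y) := Iff.rfl

/-- The permutation preserves the cyclic order of the chain. -/
def PreservesCyclicOrder {n : ℕ} (δ : Equiv.Perm (Fin n)) : Prop :=
  ∀ x y z, sbtw (δ x) (δ y) (δ z) ↔ sbtw x y z

/-- The permutation reverses the cyclic order of the chain. -/
def ReversesCyclicOrder {n : ℕ} (δ : Equiv.Perm (Fin n)) : Prop :=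
  ∀ x y z, sbtw (δ x) (δ y) (δ z) ↔ sbtw z y x

theorem preservesCyclicOrder_finRotate (n : ℕ) : PreservesCyclicOrder (finRotate n) := by
  intro x y z
  obtain _ | n := n
  · exact x.elim0
  have key : ∀ u : Fin (n + 1), ((finRotate (n + 1) u : ℕ) = u + 1 ∧ (u : ℕ) < n) ∨
      ((finRotate (n + 1) u : ℕ) = 0 ∧ (u : ℕ) = n) := by
    intro u
    by_cases hl : u = Fin.last n
    · right
      rw [hl, finRotate_last]
      exact ⟨rfl, rfl⟩
    · exact Or.inl ⟨coe_finRotate_of_ne_last hl, Fin.lt_last_iff_ne_last.2 hl⟩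
  have hx := key x
  have hy := key y
  have hz := key z
  simp only [Fin.sbtw_def, Fin.lt_def]
  omega

theorem reversesCyclicOrder_revPerm (n : ℕ) :
    ReversesCyclicOrder (Fin.revPerm : Equiv.Perm (Fin n)) := by
  intro x y z
  simp only [Fin.sbtw_def, Fin.revPerm_apply, Fin.rev_lt_rev]
  omega

theorem PreservesCyclicOrder.mul {n : ℕ} {δ ε : Equiv.Perm (Fin n)} (hδ : PreservesCyclicOrder δ)
    (hε : PreservesCyclicOrder ε) : PreservesCyclicOrder (δ * ε) :=
  fun x y z => (hδ _ _ _).trans (hε x y z)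

theorem PreservesCyclicOrder.inv {n : ℕ} {δ : Equiv.Perm (Fin n)} (hδ : PreservesCyclicOrder δ) :
    PreservesCyclicOrder δ⁻¹ := fun x y z => by
  simpa using (hδ (δ⁻¹ x) (δ⁻¹ y) (δ⁻¹ z)).symm

theorem ReversesCyclicOrder.inv {n : ℕ} {δ : Equiv.Perm (Fin n)} (hδ : ReversesCyclicOrder δ) :
    ReversesCyclicOrder δ⁻¹ := fun x y z => by
  simpa using (hδ (δ⁻¹ z) (δ⁻¹ y) (δ⁻¹ x)).symm

theorem exists_finRotate_pow_apply_zero {n : ℕ} (a : Fin (n + 1)) :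
    ∃ k : ℕ, (finRotate (n + 1) ^ k) 0 = a := by
  induction a using Fin.induction with
  | zero => exact ⟨0, rfl⟩
  | succ i ih =>
    obtain ⟨k, hk⟩ := ih
    refine ⟨k + 1, ?_⟩
    rw [pow_succ', Equiv.Perm.mul_apply, hk]
    ext
    rw [coe_finRotate_of_ne_last i.castSucc_ne_last]
    simp

theorem PreservesCyclicOrder.eq_one {n : ℕ} {δ : Equiv.Perm (Fin (n + 1))}
    (hδ : PreservesCyclicOrder δ) (h0 : δ 0 = 0) : δ = 1 := by
  have hmono : StrictMono δ := by
    intro x y hxy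
    have hy : 0 < δ y := Fin.pos_iff_ne_zero.2 fun h =>
      Fin.not_lt_zero x (δ.injective (h.trans h0.symm) ▸ hxy)
    by_cases hx : x = 0
    · rwa [hx, h0]
    · have h := (hδ 0 x y).2 (Or.inl ⟨Fin.pos_iff_ne_zero.2 hx, hxy⟩)
      rw [h0, Fin.sbtw_def] at h
      rcases h with h | h | h
      · exact h.2
      · exact absurd h.2 (Fin.not_lt_zero _)
      · exact absurd h.1 (Fin.not_lt_zero _)
  have h := Subsingleton.elim (hmono.orderIsoOfSurjective δ δ.surjective)
    (OrderIso.refl (Fin (n + 1)))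
  ext x
  exact congrArg (fun e => ((e x : Fin (n + 1)) : ℕ)) h

theorem PreservesCyclicOrder.mem_dihedralPerm {n : ℕ} {δ : Equiv.Perm (Fin n)}
    (hδ : PreservesCyclicOrder δ) : δ ∈ dihedralPerm n := by
  obtain _ | n := n
  · rw [Subsingleton.elim δ 1]
    exact one_mem _
  obtain ⟨k, hk⟩ := exists_finRotate_pow_apply_zero (δ 0)
  have hpow : ∀ k : ℕ, PreservesCyclicOrder (finRotate (n + 1) ^ k) := by
    intro k
    induction k with
    | zero => exact fun _ _ _ => Iff.rfl
    | succ k ih => rw [pow_succ]; exact ih.mul (preservesCyclicOrder_finRotate _)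
  have h1 := ((hpow k).inv.mul hδ).eq_one (by
    rw [Equiv.Perm.mul_apply, ← hk]
    exact Equiv.symm_apply_apply _ _)
  have h2 : finRotate (n + 1) ^ k = δ := inv_mul_eq_one.1 h1
  rw [← h2]
  have h3 : finRotate (n + 1) ∈ dihedralPerm (n + 1) := Subgroup.subset_closure (Or.inl rfl)
  exact pow_mem h3 k

/-- For `n ≥ 3` this identifies the dihedral group with the automorphisms and antiautomorphisms of
the cyclic order; for `n ≤ 2` every permutation satisfies both conditions. -/
theorem mem_dihedralPerm_iff {n : ℕ} {δ : Equiv.Perm (Fin n)} :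
    δ ∈ dihedralPerm n ↔ PreservesCyclicOrder δ ∨ ReversesCyclicOrder δ := by
  constructor
  · intro h
    induction h using Subgroup.closure_induction with
    | mem x hx =>
      rcases hx with rfl | rfl
      · exact Or.inl (preservesCyclicOrder_finRotate n)
      · exact Or.inr (reversesCyclicOrder_revPerm n)
    | one => exact Or.inl fun _ _ _ => Iff.rfl
    | mul x y _ _ hx hy =>
      rcases hx with hx | hx <;> rcases hy with hy | hy
      · exact Or.inl (hx.mul hy)
      · exact Or.inr fun _ _ _ => (hx _ _ _).trans (hy _ _ _)
      · exact Or.inr fun _ _ _ => (hx _ _ _).trans (hy _ _ _)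
      · exact Or.inl fun _ _ _ => (hx _ _ _).trans (hy _ _ _)
    | inv x _ hx => exact hx.imp PreservesCyclicOrder.inv ReversesCyclicOrder.inv
  · rintro (h | h)
    · exact h.mem_dihedralPerm
    · have h1 : PreservesCyclicOrder (Fin.revPerm * δ) := fun x y z =>
        (reversesCyclicOrder_revPerm n _ _ _).trans (h z y x)
      have h2 : (Fin.revPerm : Equiv.Perm (Fin n)) ∈ dihedralPerm n :=
        Subgroup.subset_closure (Or.inr rfl)
      exact (Subgroup.mul_mem_cancel_left _ h2).1 h1.mem_dihedralPerm

namespace SymInvMonoid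

variable {n : ℕ}

/-! ### Partial permutations and conjugation -/

theorem ext_app {α β : SymInvMonoid n} (h : ∀ x y, α.app x = some y ↔ β.app x = some y) : α = β :=
  PEquiv.ext fun x => Option.ext fun y => h x y

theorem mem_im {α : SymInvMonoid n} {y : Fin n} : y ∈ α.im ↔ ∃ x, α.app x = some y := by
  simp [im]

/-- It suffices to test orientation on triples of arguments in cyclic order, rather than on
increasing ones. -/
theorem isOrientationPreserving_iff_sbtw (α : SymInvMonoid n) :
    α.IsOrientationPreserving ↔ ∀ x y z x' y' z' : Fin n, sbtw x y z →
      α.app x = some x' → α.app y = some y' → α.app z = some z' → sbtw x' y' z' := by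
  rw [isOrientationPreserving_iff]
  constructor
  · intro h x y z x' y' z' hs hx hy hz
    rcases hs with ⟨h1, h2⟩ | ⟨h1, h2⟩ | ⟨h1, h2⟩
    · exact h _ _ _ _ _ _ h1 h2 hx hy hz
    · exact (h _ _ _ _ _ _ h1 h2 hy hz hx).cyclic_right
    · exact (h _ _ _ _ _ _ h1 h2 hz hx hy).cyclic_left
  · exact fun h x y z x' y' z' h1 h2 => h x y z x' y' z' (Or.inl ⟨h1, h2⟩)

/-- The partial permutation `δ⁻¹ α δ` (with maps acting on the right). -/
def conj (δ : Equiv.Perm (Fin n)) (α : SymInvMonoid n) : SymInvMonoid n :=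
  (δ.symm.toPEquiv.trans α).trans δ.toPEquiv

theorem conj_app (δ : Equiv.Perm (Fin n)) (α : SymInvMonoid n) (x y : Fin n) :
    (conj δ α).app x = some y ↔ α.app (δ⁻¹ x) = some (δ⁻¹ y) := by
  change y ∈ (δ.symm.toPEquiv.trans α).trans δ.toPEquiv x ↔
    δ⁻¹ y ∈ (show Fin n ≃. Fin n from α) (δ⁻¹ x)
  rw [PEquiv.mem_trans]
  constructor
  · rintro ⟨b, hb, hy⟩
    obtain ⟨a, ha, h⟩ := (PEquiv.mem_trans ..).1 hb
    rw [Equiv.toPEquiv_apply, Option.mem_some_iff] at ha hy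
    subst ha hy
    exact (δ.symm_apply_apply b).symm ▸ h
  · intro h
    exact ⟨_, (PEquiv.mem_trans ..).2 ⟨_, rfl, h⟩, congrArg some (δ.apply_symm_apply y)⟩

theorem conj_mul (δ : Equiv.Perm (Fin n)) (α β : SymInvMonoid n) :
    conj δ (α * β) = conj δ α * conj δ β := by
  refine ext_app fun x z => ?_
  rw [conj_app, app_mul_eq_some, app_mul_eq_some]
  simp only [conj_app]
  exact ⟨fun ⟨y, h⟩ => ⟨δ y, by simpa using h⟩, fun ⟨y, h⟩ => ⟨δ⁻¹ y, h⟩⟩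

theorem conj_inv_conj (δ : Equiv.Perm (Fin n)) (α : SymInvMonoid n) :
    conj δ⁻¹ (conj δ α) = α :=
  ext_app fun x y => by simp [conj_app]

theorem conj_conj_inv (δ : Equiv.Perm (Fin n)) (α : SymInvMonoid n) :
    conj δ (conj δ⁻¹ α) = α :=
  ext_app fun x y => by simp [conj_app]

theorem IsOrientationPreserving.conj {α : SymInvMonoid n} (hα : α.IsOrientationPreserving)
    {δ : Equiv.Perm (Fin n)} (hδ : δ ∈ dihedralPerm n) :
    (conj δ α).IsOrientationPreserving := by
  rw [isOrientationPreserving_iff_sbtw] at *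
  intro x y z x' y' z' hs hx hy hz
  rw [conj_app] at hx hy hz
  rcases mem_dihedralPerm_iff.1 (inv_mem hδ) with h | h
  · exact (h _ _ _).1 (hα _ _ _ _ _ _ ((h x y z).2 hs) hx hy hz)
  · exact (h _ _ _).1 (hα _ _ _ _ _ _ ((h z y x).2 hs) hz hy hx)

theorem im_conj_subset {α : SymInvMonoid n} {δ : Equiv.Perm (Fin n)} {Y : Finset (Fin n)}
    (h : α.im ⊆ Y) : (conj δ α).im ⊆ Y.map δ.toEmbedding := by
  intro y hy
  obtain ⟨x, hx⟩ := mem_im.1 hy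
  rw [conj_app] at hx
  exact Finset.mem_map.2 ⟨δ⁻¹ y, h (mem_im.2 ⟨_, hx⟩), by simp⟩

theorem isOrientationPreserving_of_card_im_le_two {α : SymInvMonoid n} (h : α.im.card ≤ 2) :
    α.IsOrientationPreserving := by
  rw [isOrientationPreserving_iff]
  intro x y z x' y' z' hxy hyz hx hy hz
  refine absurd (Finset.two_lt_card.2 ⟨x', mem_im.2 ⟨x, hx⟩, y', mem_im.2 ⟨y, hy⟩, z',
    mem_im.2 ⟨z, hz⟩, ?_, ?_, ?_⟩) (not_lt.2 h)
  · rintro rfl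
    exact hxy.ne (α.app_inj hx hy)
  · rintro rfl
    exact (hxy.trans hyz).ne (α.app_inj hx hz)
  · rintro rfl
    exact hyz.ne (α.app_inj hy hz)

/-! ### Maps of rank one -/

/-- The partial permutation of rank one with `x ↦ y`. -/
def single (x y : Fin n) : SymInvMonoid n := PEquiv.single x y

theorem single_app {x y u v : Fin n} : (single x y).app u = some v ↔ u = x ∧ v = y := by
  change v ∈ PEquiv.single x y u ↔ _
  rw [PEquiv.mem_single_iff]

theorem single_app_self (x y : Fin n) : (single x y).app x = some y := single_app.2 ⟨rfl, rfl⟩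

theorem single_injective {x y x' y' : Fin n} (h : single x y = single x' y') :
    x = x' ∧ y = y' := by
  have h1 := single_app_self x y
  rwa [h, single_app] at h1

theorem single_mul_single (x y z : Fin n) : single x y * single y z = single x z :=
  ext_app fun u v => by
    simp only [app_mul_eq_some, single_app]
    grind

theorem mul_single {α : SymInvMonoid n} {x y : Fin n} (h : α.app x = some y) (z : Fin n) :
    α * single y z = single x z :=
  ext_app fun u v => by
    simp only [app_mul_eq_some, single_app]
    constructor
    · rintro ⟨w, hw, rfl, rfl⟩
      exact ⟨α.app_inj hw h, rfl⟩
    · rintro ⟨rfl, rfl⟩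
      exact ⟨y, h, rfl, rfl⟩

theorem single_mem {Y : Finset (Fin n)} (x : Fin n) {y : Fin n} (hy : y ∈ Y) :
    single x y ∈ POPIRestricted Y := by
  have him : (single x y).im ⊆ {y} := fun v hv => by
    obtain ⟨u, hu⟩ := mem_im.1 hv
    exact Finset.mem_singleton.2 (single_app.1 hu).2
  refine ⟨isOrientationPreserving_of_card_im_le_two ?_,
    him.trans (Finset.singleton_subset_iff.2 hy)⟩
  exact (Finset.card_le_card him).trans (by simp)

/-- Any cyclically ordered triple is carried to any cyclically ordered triple of points of `Y` by an
element of `POPIRestricted Y`; the witness has rank three. -/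
theorem exists_mem_of_sbtw {Y : Finset (Fin n)} {x₁ x₂ x₃ y₁ y₂ y₃ : Fin n}
    (hx : sbtw x₁ x₂ x₃) (hy : sbtw y₁ y₂ y₃) (h₁ : y₁ ∈ Y) (h₂ : y₂ ∈ Y) (h₃ : y₃ ∈ Y) :
    ∃ α ∈ POPIRestricted Y, α.app x₁ = some y₁ ∧ α.app x₂ = some y₂ ∧ α.app x₃ = some y₃ := by
  have hx' := (Fin.sbtw_def ..).1 hx
  have hy' := (Fin.sbtw_def ..).1 hy
  let α : SymInvMonoid n :=
    { toFun := fun u => if u = x₁ then some y₁ else if u = x₂ then some y₂ else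
        if u = x₃ then some y₃ else none
      invFun := fun v => if v = y₁ then some x₁ else if v = y₂ then some x₂ else
        if v = y₃ then some x₃ else none
      inv := by
        intro u v
        have d1 : x₁ ≠ x₂ ∧ x₂ ≠ x₃ ∧ x₁ ≠ x₃ := by omega
        have d2 : y₁ ≠ y₂ ∧ y₂ ≠ y₃ ∧ y₁ ≠ y₃ := by omega
        grind }
  have hα : ∀ u, α.app u = if u = x₁ then some y₁ else if u = x₂ then some y₂ else
        if u = x₃ then some y₃ else none := fun _ => rfl
  have key : ∀ u v, α.app u = some v → u = x₁ ∧ v = y₁ ∨ u = x₂ ∧ v = y₂ ∨ u = x₃ ∧ v = y₃ := by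
    intro u v h
    rw [hα] at h
    grind
  refine ⟨α, ⟨?_, ?_⟩, ?_, ?_, ?_⟩
  · change α.IsOrientationPreserving
    rw [isOrientationPreserving_iff]
    intro u v w u' v' w' huv hvw hu hv hw
    rw [Fin.sbtw_def]
    rcases key _ _ hu with ⟨rfl, rfl⟩ | ⟨rfl, rfl⟩ | ⟨rfl, rfl⟩ <;>
    rcases key _ _ hv with ⟨rfl, rfl⟩ | ⟨rfl, rfl⟩ | ⟨rfl, rfl⟩ <;>
    rcases key _ _ hw with ⟨rfl, rfl⟩ | ⟨rfl, rfl⟩ | ⟨rfl, rfl⟩ <;> omega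
  · intro v hv
    obtain ⟨u, hu⟩ := mem_im.1 hv
    rcases key _ _ hu with ⟨-, rfl⟩ | ⟨-, rfl⟩ | ⟨-, rfl⟩ <;> assumption
  · simp [hα]
  · rw [hα, if_neg (by omega), if_pos rfl]
  · rw [hα, if_neg (by omega), if_neg (by omega), if_pos rfl]

/-! ### Isomorphisms are conjugations -/

/-- The empty map. -/
def empty : SymInvMonoid n := (⊥ : Fin n ≃. Fin n)

theorem empty_app (x : Fin n) : (empty : SymInvMonoid n).app x = none := rfl

theorem empty_mul (α : SymInvMonoid n) : empty * α = empty := PEquiv.bot_trans α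

theorem mul_empty (α : SymInvMonoid n) : α * empty = empty := PEquiv.trans_bot α

theorem empty_mem (Y : Finset (Fin n)) : empty ∈ POPIRestricted Y := by
  have him : (empty : SymInvMonoid n).im = ∅ := by
    ext y
    simp [mem_im, empty_app]
  exact ⟨isOrientationPreserving_of_card_im_le_two (by simp [him]), by simp [him]⟩

theorem app_of_mul_self {α : SymInvMonoid n} (h : α * α = α) {x y : Fin n}
    (hx : α.app x = some y) : x = y := by
  have h1 := hx
  rw [← h, app_mul_eq_some] at h1
  obtain ⟨z, hz, hz'⟩ := h1
  rw [α.app_inj hx hz']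
  exact (Option.some_injective _ (hx.symm.trans hz)).symm

/-- The rank-one elements of `POPIRestricted Y` in purely multiplicative terms, so that
isomorphisms preserve them. The empty map is recognised as the element `o` that is absorbing. -/
theorem exists_eq_single_iff {Y : Finset (Fin n)} (α : POPIRestricted Y) :
    (∃ x, ∃ y ∈ Y, (α : SymInvMonoid n) = single x y) ↔
      ∃ o : POPIRestricted Y, (∀ β, o * β = o ∧ β * o = o) ∧ α ≠ o ∧
        ∀ f, f * f = f → α * f = α ∨ α * f = o := by
  constructor
  · rintro ⟨x, y, -, hα⟩
    refine ⟨⟨empty, empty_mem Y⟩, fun β => ⟨Subtype.ext (empty_mul _), Subtype.ext (mul_empty _)⟩,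
      ?_, ?_⟩
    · rintro rfl
      have h := single_app_self x y
      rw [← hα, empty_app] at h
      cases h
    · intro f hf
      have hf' : (f : SymInvMonoid n) * f = f := congrArg Subtype.val hf
      cases hy : (f : SymInvMonoid n).app y with
      | none =>
        refine Or.inr (Subtype.ext (ext_app fun u v => ?_))
        change ((α : SymInvMonoid n) * f).app u = some v ↔ _
        rw [hα, app_mul_eq_some, empty_app]
        refine iff_of_false ?_ (by simp)
        rintro ⟨w, hw, hw'⟩
        rw [(single_app.1 hw).2, hy] at hw'
        cases hw'
      | some z =>
        obtain rfl := app_of_mul_self hf' hy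
        refine Or.inl (Subtype.ext (ext_app fun u v => ?_))
        change ((α : SymInvMonoid n) * f).app u = some v ↔ _
        rw [hα, app_mul_eq_some, single_app]
        constructor
        · rintro ⟨w, hw, hw'⟩
          obtain ⟨rfl, rfl⟩ := single_app.1 hw
          exact ⟨rfl, Option.some_injective _ (hw'.symm.trans hy)⟩
        · rintro ⟨rfl, rfl⟩
          exact ⟨v, single_app_self _ _, hy⟩
  · rintro ⟨o, ho, hne, h⟩
    have ho' : (o : SymInvMonoid n) = empty := by
      have h1 := congrArg Subtype.val (ho ⟨empty, empty_mem Y⟩).1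
      exact h1.symm.trans (mul_empty _)
    obtain ⟨x, y, hxy⟩ : ∃ x y, (α : SymInvMonoid n).app x = some y := by
      by_contra! hcon
      refine hne (Subtype.ext (ext_app fun u v => ?_))
      rw [ho', empty_app]
      exact iff_of_false (hcon u v) (by simp)
    have hy : y ∈ Y := α.2.2 (mem_im.2 ⟨x, hxy⟩)
    refine ⟨x, y, hy, ?_⟩
    have hmul := mul_single hxy y
    rcases h ⟨single y y, single_mem y hy⟩ (Subtype.ext (single_mul_single y y y)) with h1 | h1
    · exact (congrArg Subtype.val h1).symm.trans hmul
    · have h2 := hmul.symm.trans ((congrArg Subtype.val h1).trans ho')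
      have h3 := single_app_self x y
      rw [h2, empty_app] at h3
      cases h3

theorem exists_map_single {Y Z : Finset (Fin n)} (φ : POPIRestricted Y ≃* POPIRestricted Z)
    (x : Fin n) {y : Fin n} (hy : y ∈ Y) :
    ∃ x', ∃ y' ∈ Z, (φ ⟨single x y, single_mem x hy⟩ : SymInvMonoid n) = single x' y' := by
  obtain ⟨o, ho, hne, h⟩ := (exists_eq_single_iff ⟨single x y, single_mem x hy⟩).1 ⟨x, y, hy, rfl⟩
  refine (exists_eq_single_iff _).2 ⟨φ o, fun β => ?_, fun he => hne (φ.injective he), fun f hf => ?_⟩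
  · obtain ⟨β, rfl⟩ := φ.surjective β
    rw [← map_mul, ← map_mul, (ho β).1, (ho β).2]
    exact ⟨rfl, rfl⟩
  · obtain ⟨f, rfl⟩ := φ.surjective f
    rw [← map_mul] at hf ⊢
    exact (h f (φ.injective hf)).imp (congrArg φ) (congrArg φ)

/-- Every isomorphism is conjugation by a permutation `τ` of the whole chain with `Y τ ⊆ Z`. -/
theorem exists_perm_app_of_mulEquiv {Y Z : Finset (Fin n)} (hY : Y.Nonempty)
    (φ : POPIRestricted Y ≃* POPIRestricted Z) :
    ∃ τ : Equiv.Perm (Fin n), Y.map τ.toEmbedding ⊆ Z ∧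
      ∀ (α : POPIRestricted Y) (x y : Fin n), (α : SymInvMonoid n).app x = some y →
        (φ α : SymInvMonoid n).app (τ x) = some (τ y) := by
  obtain ⟨y₀, hy₀⟩ := hY
  have hex : ∀ x y, ∃ p : Fin n × Fin n, ∀ hy : y ∈ Y, p.2 ∈ Z ∧
      (φ ⟨single x y, single_mem x hy⟩ : SymInvMonoid n) = single p.1 p.2 := by
    intro x y
    by_cases hy : y ∈ Y
    · obtain ⟨x', y', hy', h⟩ := exists_map_single φ x hy
      exact ⟨(x', y'), fun _ => ⟨hy', h⟩⟩
    · exact ⟨(x, y), fun h => absurd h hy⟩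
  choose p hp using hex
  have hmul : ∀ (α : POPIRestricted Y) (x y z : Fin n) (hy : y ∈ Y) (hz : z ∈ Y),
      (α : SymInvMonoid n).app x = some y →
      (φ α : SymInvMonoid n) * single (p y z).1 (p y z).2 = single (p x z).1 (p x z).2 := by
    intro α x y z hy hz h
    have h1 : α * ⟨single y z, single_mem y hz⟩ = ⟨single x z, single_mem x hz⟩ :=
      Subtype.ext (mul_single h z)
    have h2 := congrArg (fun a => (φ a : SymInvMonoid n)) h1
    simp only [map_mul, MulMemClass.coe_mul] at h2
    rwa [(hp y z hz).2, (hp x z hz).2] at h2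
  have happ : ∀ (α : POPIRestricted Y) (x y z : Fin n) (hy : y ∈ Y) (hz : z ∈ Y),
      (α : SymInvMonoid n).app x = some y →
      (φ α : SymInvMonoid n).app (p x z).1 = some (p y z).1 := by
    intro α x y z hy hz h
    have h1 := single_app_self (p x z).1 (p x z).2
    rw [← hmul α x y z hy hz h, app_mul_eq_some] at h1
    obtain ⟨w, hw, hw'⟩ := h1
    rwa [(single_app.1 hw').1] at hw
  -- The first coordinate of `p x y` does not depend on `y`.
  have hfst : ∀ x y z, y ∈ Y → z ∈ Y → (p x z).1 = (p x y).1 ∧ (p y z).1 = (p x y).2 := by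
    intro x y z hy hz
    have h1 := happ ⟨single x y, single_mem x hy⟩ x y z hy hz (single_app_self x y)
    rw [(hp x y hy).2] at h1
    exact single_app.1 h1
  have hinj : Function.Injective fun x => (p x y₀).1 := by
    intro x x' h
    have h1 := (hfst x y₀ y₀ hy₀ hy₀).2
    have h2 := (hfst x' y₀ y₀ hy₀ hy₀).2
    have h3 : φ ⟨single x y₀, single_mem x hy₀⟩ = φ ⟨single x' y₀, single_mem x' hy₀⟩ := by
      refine Subtype.ext ?_
      rw [(hp x y₀ hy₀).2, (hp x' y₀ hy₀).2, ← h1, ← h2]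
      exact congrArg (fun u => single u _) h
    exact (single_injective (congrArg Subtype.val (φ.injective h3))).1
  refine ⟨Equiv.ofBijective _ (Finite.injective_iff_bijective.1 hinj), ?_, ?_⟩
  · intro z hz
    obtain ⟨y, hy, rfl⟩ := Finset.mem_map.1 hz
    change (p y y₀).1 ∈ Z
    rw [(hfst y y y₀ hy hy₀).2]
    exact (hp y y hy).1
  · intro α x y h
    exact happ α x y y₀ (α.2.2 (mem_im.2 ⟨x, h⟩)) hy₀ h

theorem map_eq_of_mulEquiv {Y Z : Finset (Fin n)} (hZ : Z.Nonempty)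
    (φ : POPIRestricted Y ≃* POPIRestricted Z) {τ : Equiv.Perm (Fin n)}
    (hτ : Y.map τ.toEmbedding ⊆ Z) : Y.map τ.toEmbedding = Z := by
  obtain ⟨ρ, hρ, -⟩ := exists_perm_app_of_mulEquiv hZ φ.symm
  refine Finset.eq_of_subset_of_card_le hτ ?_
  simpa using Finset.card_le_card hρ

/-- When `Y` contains a cyclically ordered triple, a conjugation between the two semigroups is by
a dihedral permutation. -/
theorem mem_dihedralPerm_of_app {Y Z : Finset (Fin n)} (hcard : 2 < Y.card)
    (φ : POPIRestricted Y ≃* POPIRestricted Z) {τ : Equiv.Perm (Fin n)}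
    (hτ : ∀ (α : POPIRestricted Y) (x y : Fin n), (α : SymInvMonoid n).app x = some y →
      (φ α : SymInvMonoid n).app (τ x) = some (τ y)) : τ ∈ dihedralPerm n := by
  obtain ⟨a, b, c, ha, hb, hc, habc⟩ : ∃ a b c, a ∈ Y ∧ b ∈ Y ∧ c ∈ Y ∧ sbtw a b c := by
    obtain ⟨a, ha, b, hb, c, hc, hab, hac, hbc⟩ := Finset.two_lt_card.1 hcard
    by_cases h : sbtw a b c
    · exact ⟨a, b, c, ha, hb, hc, h⟩
    · refine ⟨c, b, a, hc, hb, ha, ?_⟩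
      rw [Fin.sbtw_def] at h ⊢
      omega
  have key : ∀ x y z, sbtw x y z →
      (sbtw (τ x) (τ y) (τ z) → sbtw (τ a) (τ b) (τ c)) ∧
      (sbtw (τ z) (τ y) (τ x) → sbtw (τ c) (τ b) (τ a)) := by
    intro x y z h
    obtain ⟨α, hα, hx, hy, hz⟩ := exists_mem_of_sbtw h habc ha hb hc
    have hop := (isOrientationPreserving_iff_sbtw _).1 (φ ⟨α, hα⟩).2.1
    have hx' := hτ ⟨α, hα⟩ _ _ hx
    have hy' := hτ ⟨α, hα⟩ _ _ hy
    have hz' := hτ ⟨α, hα⟩ _ _ hz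
    exact ⟨fun h => hop _ _ _ _ _ _ h hx' hy' hz', fun h => hop _ _ _ _ _ _ h hz' hy' hx'⟩
  have asymm : ∀ x y z : Fin n, sbtw x y z → ¬ sbtw z y x := by
    intro x y z h
    rw [Fin.sbtw_def] at h ⊢
    omega
  have total : ∀ x y z : Fin n, x ≠ y → y ≠ z → x ≠ z → sbtw x y z ∨ sbtw z y x := by
    intro x y z _ _ _
    rw [Fin.sbtw_def, Fin.sbtw_def]
    omega
  have ne : ∀ x y z : Fin n, sbtw x y z → x ≠ y ∧ y ≠ z ∧ x ≠ z := by
    intro x y z h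
    rw [Fin.sbtw_def] at h
    omega
  have totalτ : ∀ x y z, sbtw x y z → sbtw (τ x) (τ y) (τ z) ∨ sbtw (τ z) (τ y) (τ x) := by
    intro x y z h
    obtain ⟨h1, h2, h3⟩ := ne _ _ _ h
    exact total _ _ _ (τ.injective.ne h1) (τ.injective.ne h2) (τ.injective.ne h3)
  have ne' : ∀ x y z, sbtw (τ x) (τ y) (τ z) → sbtw x y z ∨ sbtw z y x := by
    intro x y z h
    obtain ⟨h1, h2, h3⟩ := ne _ _ _ h
    exact total _ _ _ (fun e => h1 (congrArg τ e)) (fun e => h2 (congrArg τ e))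
      (fun e => h3 (congrArg τ e))
  rw [mem_dihedralPerm_iff]
  rcases totalτ a b c habc with h | h
  · have hp : ∀ x y z, sbtw x y z → sbtw (τ x) (τ y) (τ z) := fun x y z hs =>
      (totalτ x y z hs).resolve_right fun h' => asymm _ _ _ h ((key x y z hs).2 h')
    exact Or.inl fun x y z => ⟨fun h' => (ne' x y z h').resolve_right
      fun hs => asymm _ _ _ h' (hp _ _ _ hs), hp x y z⟩
  · have hp : ∀ x y z, sbtw x y z → sbtw (τ z) (τ y) (τ x) := fun x y z hs =>
      (totalτ x y z hs).resolve_left fun h' => asymm _ _ _ h ((key x y z hs).1 h')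
    exact Or.inr fun x y z => ⟨fun h' => (ne' x y z h').resolve_left
      fun hs => asymm _ _ _ h' (hp _ _ _ hs), hp z y x⟩

/-! ### Conjugations are isomorphisms -/

theorem nonempty_mulEquiv_of_conj {Y Z : Finset (Fin n)} (δ : Equiv.Perm (Fin n))
    (h : ∀ α ∈ POPIRestricted Y, conj δ α ∈ POPIRestricted Z)
    (h' : ∀ α ∈ POPIRestricted Z, conj δ⁻¹ α ∈ POPIRestricted Y) :
    Nonempty (POPIRestricted Y ≃* POPIRestricted Z) :=
  ⟨{ toFun := fun α => ⟨conj δ α, h α α.2⟩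
     invFun := fun α => ⟨conj δ⁻¹ α, h' α α.2⟩
     left_inv := fun α => Subtype.ext (conj_inv_conj δ α)
     right_inv := fun α => Subtype.ext (conj_conj_inv δ α)
     map_mul' := fun α β => Subtype.ext (conj_mul δ α β) }⟩

theorem exists_perm_map_eq {Y Z : Finset (Fin n)} (h : Y.card = Z.card) :
    ∃ δ : Equiv.Perm (Fin n), Y.map δ.toEmbedding = Z := by
  let e : {x // x ∈ Y} ≃ {x // x ∈ Z} := Finset.equivOfCardEq h
  refine ⟨e.extendSubtype, Finset.eq_of_subset_of_card_le ?_ (by simp [h])⟩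
  intro z hz
  obtain ⟨y, hy, rfl⟩ := Finset.mem_map.1 hz
  exact e.extendSubtype_mem y hy

theorem map_inv_eq {Y Z : Finset (Fin n)} {δ : Equiv.Perm (Fin n)}
    (h : Y.map δ.toEmbedding = Z) : Z.map (δ⁻¹ : Equiv.Perm (Fin n)).toEmbedding = Y := by
  subst h
  ext x
  simp only [Finset.mem_map_equiv]
  exact iff_of_eq (congrArg (· ∈ Y) (δ.symm_apply_apply x))

end SymInvMonoid

open SymInvMonoid in
theorem mainTheorem2 (n : ℕ) (Y Z : Finset (Fin n)) (hY : Y.Nonempty) (hZ : Z.Nonempty) :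
    Nonempty (POPIRestricted Y ≃* POPIRestricted Z) ↔
      ((Y.card = Z.card ∧ Z.card ≤ 2) ∨
        ∃ δ ∈ dihedralPerm n, Y.map (Equiv.toEmbedding δ) = Z) := by
  constructor
  · rintro ⟨φ⟩
    obtain ⟨τ, hsub, happ⟩ := exists_perm_app_of_mulEquiv hY φ
    have hmap := map_eq_of_mulEquiv hZ φ hsub
    have hcard : Y.card = Z.card := by rw [← hmap, Finset.card_map]
    by_cases h2 : Z.card ≤ 2
    · exact Or.inl ⟨hcard, h2⟩
    · exact Or.inr ⟨τ, mem_dihedralPerm_of_app (by omega) φ happ, hmap⟩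
  · rintro (⟨hcard, h2⟩ | ⟨δ, hδ, hmap⟩)
    · obtain ⟨δ, hmap⟩ := exists_perm_map_eq hcard
      have hmem : ∀ {W : Finset (Fin n)} {α : SymInvMonoid n}, W.card ≤ 2 → α.im ⊆ W →
          α ∈ POPIRestricted W := fun hW h =>
        ⟨isOrientationPreserving_of_card_im_le_two ((Finset.card_le_card h).trans hW), h⟩
      exact nonempty_mulEquiv_of_conj δ
        (fun α hα => hmem h2 (hmap ▸ im_conj_subset hα.2))
        (fun α hα => hmem (hcard.trans_le h2) (map_inv_eq hmap ▸ im_conj_subset hα.2))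
    · exact nonempty_mulEquiv_of_conj δ
        (fun α hα => ⟨hα.1.conj hδ, hmap ▸ im_conj_subset hα.2⟩)
        (fun α hα => ⟨hα.1.conj (inv_mem hδ), map_inv_eq hmap ▸ im_conj_subset hα.2⟩)
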